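/- Conventions. Let $2=\{0,1\}$ with $0<1$. All functions below are Boolean functions $f:2^n\to 2$ of countable arity $0<n\le\omega$, and all relations are sets $R\subseteq 2^k$ of countable arity $k\le\omega$; $2^n$ and $2^k$ carry the bitwise order and the product topology. A function $f:2^n\to2$ is *Borel* if it is the indicator function of a Borel set, and *monotone* if $\vec x\le\vec y$ implies $f(\vec x)\le f(\vec y)$; let $\mathrm{Mono}$ be the class of all monotone functions. A function $f:2^n\to 2$ *preserves* $R\subseteq 2^k$ if, for every matrix $(x_{i,j})_{i<k,\,j<n}$ of bits such that $(x_{i,j})_{i<k}\in R$ for each $j<n$, one has $\bigl(f((x_{i,j})_{j<n})\bigr)_{i<k}\in R$. For a set $\mathcal M$ of relations, $\mathrm{Pol}^{\mathrm{Borel}}(\mathcal M)$ is the class of all Borel functions that preserve every $R\in\mathcal M$. For $f:2^n\to2$ let $\uparrow\! f:2^n\to 2$, $(\uparrow\! f)(\vec x)=\bigvee_{\vec y\le\vec x}f(\vec y)$; this is the least monotone function $\ge f$, and need not be Borel when $f$ is. For a class $G$ of functions let $\downarrow G$ be the class of all functions $f:2^n\to 2$ (Borel or not) such that $f\le g$ pointwise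 for some $n$-ary $g\in G$. Proposition. Let $\mathcal M$ be a countable set of relations $R\subseteq 2^k$, $k\le\omega$, each of which is Borel and downward-closed (i.e. $\vec y\le\vec x\in R$ implies $\vec y\in R$), and let $F=\mathrm{Pol}^{\mathrm{Borel}}(\mathcal M)$ contain the binary conjunction $\wedge:2^2\to2$. Then $\{\uparrow\! f : f\in F\}\subseteq\ \downarrow(F\cap\mathrm{Mono})$; that is, for every $f\in F$ there is a monotone Borel function $h\in F$ of the same arity with $\uparrow\! f\le h$. Consequently $F\subseteq\ \downarrow(F\cap\mathrm{Mono})$. -/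

import Mathlib

namespace BoolClone

/-- The index set `n = {i | i < n}` of an arity `n ≤ ω`; here `ω` is `⊤ : ℕ∞`. -/
abbrev Idx (n : ℕ∞) : Type := {i : ℕ // (i : ℕ∞) < n}

/-- The space `2^n`, `n ≤ ω`, of bit strings of length `n`. It carries Mathlib's pointwise order
(with `false < true`) and the product σ-algebra, which is generated by the sets `x i = true`;
since `n` is countable, its measurable sets are exactly the Borel sets. -/
abbrev Cube (n : ℕ∞) : Type := Idx n → Bool

/-- A Boolean function `f : 2^n → 2` of countable arity `n`, where `0 < n ≤ ω`
(nullary functions are excluded). -/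
structure BoolFun where
  arity : ℕ∞
  arity_pos : 0 < arity
  toFun : Cube arity → Bool

/-- A relation `R ⊆ 2^k` on `2` of countable arity `k ≤ ω`. -/
structure BoolRel where
  arity : ℕ∞
  carrier : Set (Cube arity)

/-- `f` preserves `R`: for every `k × n` matrix `x` of bits all of whose columns lie in `R`,
the column obtained by applying `f` to each row lies in `R`. -/
def Preserves (f : BoolFun) (R : BoolRel) : Prop :=
  ∀ x : Idx R.arity → Cube f.arity,
    (∀ j : Idx f.arity, (fun i => x i j) ∈ R.carrier) → (fun i => f.toFun (x i)) ∈ R.carrier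

/-- The polymorphisms of `M` of countable arity. -/
def Pol (M : Set BoolRel) : Set BoolFun :=
  {f | ∀ R ∈ M, Preserves f R}

/-- The Borel functions of countable arity. -/
def BorelFun : Set BoolFun :=
  {f | Measurable f.toFun}

/-- The Borel polymorphisms of `M`. -/
def PolBorel (M : Set BoolRel) : Set BoolFun :=
  Pol M ∩ BorelFun

/-- The monotone functions of countable arity. -/
def Mono : Set BoolFun :=
  {f | Monotone f.toFun}

/-- Binary conjunction. -/
def conj : BoolFun where
  arity := 2
  arity_pos := by norm_num
  toFun x := x ⟨0, by norm_num⟩ && x ⟨1, by norm_num⟩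

open Classical in
/-- The function `↑f` of the same arity, `(↑f)(x) = ⋁ {f(y) | y ≤ x}`: the indicator function of
the upward closure of `f⁻¹(1)` in `2^n`. -/
noncomputable def up (f : BoolFun) : BoolFun where
  arity := f.arity
  arity_pos := f.arity_pos
  toFun x := decide (∃ y : Cube f.arity, y ≤ x ∧ f.toFun y = true)

/-- The pointwise downward closure `↓G`: all functions (Borel or not) that are pointwise bounded
above by a function of the same arity in `G`. -/
def down (G : Set BoolFun) : Set BoolFun :=
  {f | ∃ g : Cube f.arity → Bool, (⟨f.arity, f.arity_pos, g⟩ : BoolFun) ∈ G ∧ f.toFun ≤ g}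

end BoolClone

/-!
If `f` preserves a downward-closed relation `R`, then so does `↑f`: whenever `↑f` is true at a row
of a matrix, replace that row by a smaller one at which `f` is true. So it is enough to enlarge the
analytic upper set `{x | (↑f)(x) = 1}` to a Borel upper set without losing the preservation of any
`R ∈ M`. Since `R` is downward-closed, the indicator of `B` preserves `R` exactly when every matrix
`x` with columns in `R` and every `S ∉ R` have a row `i ∈ S` with `x i ∉ B`. This condition
is antitone in `B` (so that, `M` being countable, the relations may be treated one at a time), and
the pairs `(S, x)` in question form a Borel set `Z`.

This is an instance of the first reflection theorem, with enough care that the reflecting Borel set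
is an upper set. Let `{f = 1}`, if nonempty, be the range of a continuous `g` on `ℕ → ℕ`. A point
`x` lies in the upper closure iff the tree of finite attempts at a `z` with `g z ≤ x` has an
infinite branch, and this tree increases with `x`. Hence the set `Approx g ξ []` of the `x` whose tree has rank at
least `ξ` is an upper set containing `{↑f = 1}`; it is Borel for countable `ξ`
(`measurableSet_approx`). Next consider the countable tree `Joint G g` of simultaneous attempts at a
pair `(S, x) ∈ Z = range G` and, for each `i ∈ S`, at a `z` with `g z ≤ x i`. An infinite branch
would be a failure of preservation by `↑f`, so the tree has a countable rank
(`acc_jointExt_nil`). But a pair `(S, x) ∈ Z` with `x i ∈ Approx g ξ []` for all `i ∈ S`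
forces that rank to be at least `ξ` (`le_rank_joint`). Therefore `Approx g ξ []` is the desired
set as soon as `ξ` exceeds the rank.
-/

namespace BoolClone

open PiNat Set

/-! ### Products of Polish spaces -/

instance polishSpace_pi {ι : Type*} [Countable ι] {X : ι → Type*} [∀ i, TopologicalSpace (X i)]
    [∀ i, PolishSpace (X i)] : PolishSpace (∀ i, X i) where

instance polishSpace_prod {X Y : Type*} [TopologicalSpace X] [TopologicalSpace Y] [PolishSpace X]
    [PolishSpace Y] : PolishSpace (X × Y) where

/-! ### Locally constant functions on sequences -/

/-- A continuous Boolean function on sequences is determined near `z` by a finite prefix of `z`. -/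
lemma exists_res_eq_imp_eq {h : (ℕ → ℕ) → Bool} (hh : Continuous h) (z : ℕ → ℕ) :
    ∃ N, ∀ m, N ≤ m → ∀ z', res z' m = res z m → h z' = h z := by
  have hopen : IsOpen (h ⁻¹' {h z}) := (isOpen_discrete _).preimage hh
  obtain ⟨_, ⟨y, N, rfl⟩, hz, hsub⟩ :=
    (isTopologicalBasis_cylinders (fun _ => ℕ)).exists_subset_of_mem_open
      (show z ∈ h ⁻¹' {h z} from rfl) hopen
  refine ⟨N, fun m hm z' hz' => hsub fun i hi => ?_⟩
  rw [res_eq_res.1 hz' (hi.trans_le hm)]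
  exact hz i hi

/-! ### Approximations from above to an analytic upper set -/

section Approx

variable {J : Type} [Encodable J] {g : (ℕ → ℕ) → J → Bool}

/-- The points `x` for which the finite sequence `s` is a node of the tree of attempts at a `z` with
`g z ≤ x`: some `z` extending `s` satisfies the inequality at the coordinates with code less than
the length of `s`. Finite sequences are listed with the last entry first, as in `PiNat.res`. -/
def Node (g : (ℕ → ℕ) → J → Bool) (s : List ℕ) : Set (J → Bool) :=
  {x | ∃ z, res z s.length = s ∧ ∀ j, Encodable.encode j < s.length → g z j ≤ x j}

/-- The points `x` for which `s` has rank at least `ξ` in the tree of attempts at a `z` with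
`g z ≤ x`. -/
def Approx (g : (ℕ → ℕ) → J → Bool) (ξ : Ordinal.{0}) (s : List ℕ) : Set (J → Bool) :=
  {x | x ∈ Node g s ∧ ∀ η, η < ξ → ∃ a, x ∈ Approx g η (a :: s)}
termination_by ξ

lemma mem_approx {ξ : Ordinal.{0}} {s : List ℕ} {x : J → Bool} :
    x ∈ Approx g ξ s ↔ x ∈ Node g s ∧ ∀ η, η < ξ → ∃ a, x ∈ Approx g η (a :: s) := by
  rw [Approx]; rfl

lemma approx_anti {ξ η : Ordinal.{0}} (h : η ≤ ξ) (s : List ℕ) : Approx g ξ s ⊆ Approx g η s := by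
  intro x hx
  rw [mem_approx] at hx ⊢
  exact ⟨hx.1, fun ζ hζ => hx.2 ζ (hζ.trans_le h)⟩

lemma mem_approx_of_le {z : ℕ → ℕ} {x : J → Bool} (h : g z ≤ x) (ξ : Ordinal.{0}) (m : ℕ) :
    x ∈ Approx g ξ (res z m) := by
  induction ξ using WellFoundedLT.induction generalizing m with
  | _ ξ ih =>
    rw [mem_approx]
    exact ⟨⟨z, by rw [res_length], fun j _ => h j⟩, fun η hη => ⟨z m, ih η hη (m + 1)⟩⟩

lemma isUpperSet_approx (ξ : Ordinal.{0}) (s : List ℕ) : IsUpperSet (Approx g ξ s) := by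
  induction ξ using WellFoundedLT.induction generalizing s with
  | _ ξ ih =>
    intro x y hxy hx
    rw [mem_approx] at hx ⊢
    obtain ⟨⟨z, hz, hzx⟩, hx⟩ := hx
    refine ⟨⟨z, hz, fun j hj => (hzx j hj).trans (hxy j)⟩, fun η hη => ?_⟩
    obtain ⟨a, ha⟩ := hx η hη
    exact ⟨a, ih η hη _ hxy ha⟩

lemma isOpen_node (s : List ℕ) : IsOpen (Node g s) := by
  have hfin : {j : J | Encodable.encode j < s.length}.Finite :=
    (finite_lt_nat s.length).preimage Encodable.encode_injective.injOn
  have : Node g s = ⋃ z ∈ {z | res z s.length = s},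
      {j : J | Encodable.encode j < s.length}.pi fun j => Ici (g z j) := by
    ext x
    simp [Node, Set.pi]
  rw [this]
  exact isOpen_biUnion fun z _ => isOpen_set_pi hfin fun _ _ => isOpen_discrete _

lemma measurableSet_approx {ξ : Ordinal.{0}} (hξ : (Iio ξ).Countable) (s : List ℕ) :
    MeasurableSet (Approx g ξ s) := by
  induction ξ using WellFoundedLT.induction generalizing s with
  | _ ξ ih =>
    have : Approx g ξ s = Node g s ∩ ⋂ η ∈ Iio ξ, ⋃ a, Approx g η (a :: s) := by
      ext x
      rw [mem_approx]
      simp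
    rw [this]
    refine (isOpen_node s).measurableSet.inter (MeasurableSet.biInter hξ fun η hη => ?_)
    exact MeasurableSet.iUnion fun a => ih η hη (hξ.mono (Iio_subset_Iio (le_of_lt hη))) _

end Approx

/-! ### The joint tree of attempts -/

section Joint

/-- The `i`-th of the finite sequences coded by a list of pairs `(a, l)`, last pair first. Only the
pairs from position `i` on contribute, each by the `i`-th entry of its `l`; so at any stage
only finitely many of the sequences are nonempty. -/
def row (i : ℕ) : List (ℕ × List ℕ) → List ℕ
  | [] => []
  | c :: u => if i ≤ u.length then c.2.getD i 0 :: row i u else row i u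

lemma row_res (i : ℕ) (b : ℕ → ℕ × List ℕ) (m : ℕ) :
    row i (res b m) = res (fun l => (b (i + l)).2.getD i 0) (m - i) := by
  induction m with
  | zero => simp [row]
  | succ m ih =>
    rw [res_succ, row, res_length, ih]
    split_ifs with h
    · rw [Nat.succ_sub h, res_succ, Nat.add_sub_cancel' h]
    · rw [Nat.sub_eq_zero_of_le (not_le.1 h), Nat.sub_eq_zero_of_le (not_le.1 h).le]

lemma map_fst_res (b : ℕ → ℕ × List ℕ) (m : ℕ) :
    (res b m).map Prod.fst = res (fun l => (b l).1) m := by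
  induction m with
  | zero => rfl
  | succ m ih => rw [res_succ, List.map_cons, ih, res_succ]

variable {I J : Type} [Encodable I] [Encodable J]
  {G : (ℕ → ℕ) → (I → Bool) × (I → J → Bool)} {g : (ℕ → ℕ) → J → Bool}

/-- The tree of finite attempts at a sequence `z` and, for each `i` in the first component `S` of
`G z = (S, x)`, a sequence `w i` with `g (w i) ≤ x i`. The first components of the entries code a
prefix of `z`, and the `row`s code prefixes of the `w i`. -/
def Joint (G : (ℕ → ℕ) → (I → Bool) × (I → J → Bool)) (g : (ℕ → ℕ) → J → Bool) :
    Set (List (ℕ × List ℕ)) :=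
  {u | ∃ z, res z u.length = u.map Prod.fst ∧
    ∀ i, (G z).1 i = true → (G z).2 i ∈ Node g (row (Encodable.encode i) u)}

/-- `JointExt G g v u`: the sequence `v` is in `Joint G g` and extends `u` by one entry. -/
def JointExt (G : (ℕ → ℕ) → (I → Bool) × (I → J → Bool)) (g : (ℕ → ℕ) → J → Bool)
    (v u : List (ℕ × List ℕ)) : Prop :=
  v ∈ Joint G g ∧ ∃ c, v = c :: u

/-- If no pair `(S, x)` in the range of `G` has all `x i`, `i ∈ S`, above points of the range of
`g`, then the joint tree has no infinite branch. -/
lemma acc_jointExt_nil (hG : Continuous G) (hg : Continuous g)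
    (h : ∀ z, ∃ i, (G z).1 i = true ∧ ∀ w, ¬ g w ≤ (G z).2 i) :
    Acc (JointExt G g) [] := by
  by_contra hacc
  obtain ⟨F, hF0, hF⟩ := not_acc_iff_exists_descending_chain.1 hacc
  choose hmem b hb using hF
  have hFres : ∀ n, F n = res b n := by
    intro n
    induction n with
    | zero => exact hF0
    | succ n ih => rw [hb, ih, res_succ]
  obtain ⟨i, hi, hno⟩ := h fun l => (b l).1
  set z : ℕ → ℕ := fun l => (b l).1 with hz
  set e := Encodable.encode i with he
  -- The branch `b` codes `z` and `w`; it contradicts `hno` at `w`, coordinate by coordinate.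
  set w : ℕ → ℕ := fun l => (b (e + l)).2.getD e 0 with hw
  refine hno w fun j => ?_
  have hG1 : Continuous fun z => (G z).1 i := (continuous_apply i).comp (continuous_fst.comp hG)
  have hG2 : Continuous fun z => (G z).2 i j :=
    (continuous_apply j).comp ((continuous_apply i).comp (continuous_snd.comp hG))
  obtain ⟨N₁, hN₁⟩ := exists_res_eq_imp_eq hG1 z
  obtain ⟨N₂, hN₂⟩ := exists_res_eq_imp_eq hG2 z
  obtain ⟨N₃, hN₃⟩ := exists_res_eq_imp_eq ((continuous_apply j).comp hg) w
  let m := N₁ + N₂ + N₃ + e + Encodable.encode j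
  have hm := hmem m
  rw [hFres] at hm
  obtain ⟨z', hz', hnode⟩ := hm
  rw [res_length, map_fst_res] at hz'
  have h1 : (G z').1 i = true := (hN₁ (m + 1) (by omega) z' hz').trans hi
  have h2 : (G z').2 i j = (G z).2 i j := hN₂ (m + 1) (by omega) z' hz'
  obtain ⟨w', hw', hle⟩ := hnode i h1
  rw [row_res, res_length] at hw' hle
  have h3 : g w' j = g w j := hN₃ (m + 1 - e) (by omega) w' hw'
  have h4 := hle j (by omega)
  rwa [h2, h3] at h4

/-- A pair `G z = (S, x)` with all `x i`, `i ∈ S`, in the `ξ`-th approximation makes the rank of the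
joint tree at least `ξ`. All the rows extend at once: any `η < ξ` is admissible for each of
them. -/
lemma le_rank_joint {z : ℕ → ℕ} {ξ : Ordinal.{0}} {u : List (ℕ × List ℕ)}
    (hz : res z u.length = u.map Prod.fst)
    (hrow : ∀ i, (G z).1 i = true → (G z).2 i ∈ Approx g ξ (row (Encodable.encode i) u))
    (hu : Acc (JointExt G g) u) : ξ ≤ hu.rank := by
  induction ξ using WellFoundedLT.induction generalizing u with
  | _ ξ ih =>
    refine le_of_forall_lt fun η hη => ?_
    have hex : ∀ i, ∃ a, (G z).1 i = true →
        (G z).2 i ∈ Approx g η (a :: row (Encodable.encode i) u) := by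
      intro i
      by_cases hi : (G z).1 i = true
      · obtain ⟨a, ha⟩ := (mem_approx.1 (hrow i hi)).2 η hη
        exact ⟨a, fun _ => ha⟩
      · exact ⟨0, fun h => absurd h hi⟩
    choose a ha using hex
    set l : List ℕ := (List.range (u.length + 1)).map (Function.extend Encodable.encode a 0) with hl
    have hz' : res z ((z u.length, l) :: u).length = ((z u.length, l) :: u).map Prod.fst := by
      rw [List.length_cons, res_succ, hz, List.map_cons]
    have hrow' : ∀ i, (G z).1 i = true →
        (G z).2 i ∈ Approx g η (row (Encodable.encode i) ((z u.length, l) :: u)) := by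
      intro i hi
      rw [row]
      split_ifs with hiu
      · have : l.getD (Encodable.encode i) 0 = a i := by
          rw [hl, List.getD_eq_getElem?_getD, List.getElem?_map,
            List.getElem?_range (Nat.lt_succ_of_le hiu)]
          exact Encodable.encode_injective.extend_apply a 0 i
        rw [this]
        exact ha i hi
      · exact approx_anti hη.le _ (hrow i hi)
    have hext : JointExt G g ((z u.length, l) :: u) u :=
      ⟨⟨z, hz', fun i hi => (mem_approx.1 (hrow' i hi)).1⟩, _, rfl⟩
    exact (ih η hη hz' hrow' (hu.inv hext)).trans_lt (hu.rank_lt_of_rel hext)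

end Joint

/-! ### Reflection -/

/-- A form of the first reflection theorem for upper sets: if for each `(S, x)` in the analytic set
`Z` some `x i`, `i ∈ S`, lies outside the upper closure of the analytic set `A`, then this closure
can be enlarged to a Borel upper set with the same property. -/
theorem exists_measurable_upperSet {I J : Type} [Countable I] [Countable J]
    {A : Set (J → Bool)} (hA : MeasureTheory.AnalyticSet A)
    {Z : Set ((I → Bool) × (I → J → Bool))} (hZ : MeasureTheory.AnalyticSet Z)
    (h : ∀ p ∈ Z, ∃ i, p.1 i = true ∧ p.2 i ∉ upperClosure A) :
    ∃ B : Set (J → Bool), MeasurableSet B ∧ IsUpperSet B ∧ A ⊆ B ∧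
      ∀ p ∈ Z, ∃ i, p.1 i = true ∧ p.2 i ∉ B := by
  obtain ⟨_⟩ := nonempty_encodable I
  obtain ⟨_⟩ := nonempty_encodable J
  rw [MeasureTheory.AnalyticSet] at hA hZ
  rcases hA with rfl | ⟨g, hg, rfl⟩
  · exact ⟨∅, MeasurableSet.empty, isUpperSet_empty, Subset.rfl, fun p hp => by
      obtain ⟨i, hi, -⟩ := h p hp
      exact ⟨i, hi, notMem_empty _⟩⟩
  rcases hZ with rfl | ⟨G, hG, rfl⟩
  · exact ⟨univ, MeasurableSet.univ, isUpperSet_univ, subset_univ _, fun p hp => hp.elim⟩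
  have hacc : Acc (JointExt G g) [] := by
    refine acc_jointExt_nil hG hg fun z => ?_
    obtain ⟨i, hi, hno⟩ := h _ (mem_range_self z)
    exact ⟨i, hi, fun w hw => hno ⟨g w, mem_range_self w, hw⟩⟩
  -- The ordinals up to the rank of the tree are ranks of its nodes, hence countable in number.
  have hcount : (Iio (Order.succ hacc.rank)).Countable := by
    refine (countable_range fun b : {b // Acc (JointExt G g) b} => b.2.rank).mono fun o ho => ?_
    obtain ⟨b, hb, rfl⟩ := hacc.mem_range_rank_of_le (Order.lt_succ_iff.1 ho)
    exact ⟨⟨b, hb⟩, rfl⟩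
  refine ⟨Approx g (Order.succ hacc.rank) [], measurableSet_approx hcount _,
    isUpperSet_approx _ _, ?_, ?_⟩
  · rintro _ ⟨z, rfl⟩
    exact mem_approx_of_le le_rfl _ 0
  · rintro _ ⟨z, rfl⟩
    by_contra! hcon
    exact (le_rank_joint (u := []) rfl hcon hacc).not_gt (Order.lt_succ _)

/-! ### Preservation of downward-closed relations -/

/-- The pairs `(S, x)` of a column `S` outside `R` and a matrix `x` all of whose columns are in `R`;
a function preserves `R` if for each such pair it vanishes at some row `x i`, `i ∈ S`; the converse
holds when `R` is downward-closed. -/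
def violations (R : BoolRel) (n : ℕ∞) : Set (Cube R.arity × (Idx R.arity → Cube n)) :=
  {p | p.1 ∉ R.carrier ∧ ∀ j, (fun i => p.2 i j) ∈ R.carrier}

lemma measurableSet_violations {R : BoolRel} (hR : MeasurableSet R.carrier) (n : ℕ∞) :
    MeasurableSet (violations R n) := by
  have : violations R n =
      Prod.fst ⁻¹' R.carrierᶜ ∩ ⋂ j,
        (fun p : Cube R.arity × (Idx R.arity → Cube n) => fun i => p.2 i j) ⁻¹' R.carrier := by
    ext p
    simp [violations]
  rw [this]
  refine (measurable_fst hR.compl).inter (MeasurableSet.iInter fun j => ?_)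
  exact (measurable_pi_lambda _ fun i =>
    (measurable_pi_apply j).comp ((measurable_pi_apply i).comp measurable_snd)) hR

/-- A function preserving a downward-closed relation still satisfies, after passing to the upper
closure of its support, the criterion for preservation. -/
lemma exists_notMem_upperClosure {f : BoolFun} {R : BoolRel} (hR : IsLowerSet R.carrier)
    (hf : Preserves f R) {p : Cube R.arity × (Idx R.arity → Cube f.arity)}
    (hp : p ∈ violations R f.arity) :
    ∃ i, p.1 i = true ∧ p.2 i ∉ upperClosure {y | f.toFun y = true} := by
  by_contra! hcon
  have hex : ∀ i, ∃ y, y ≤ p.2 i ∧ (p.1 i = true → f.toFun y = true) := by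
    intro i
    by_cases hi : p.1 i = true
    · obtain ⟨y, hy, hyx⟩ := hcon i hi
      exact ⟨y, hyx, fun _ => hy⟩
    · exact ⟨p.2 i, le_rfl, fun h => absurd h hi⟩
  choose y hyx hy using hex
  refine hp.1 (hR (fun i => ?_) (hf y fun j => hR (fun i => hyx i j) (hp.2 j)))
  exact Bool.le_iff_imp.2 (hy i)

open Classical in
/-- The Boolean function with support `B`. -/
noncomputable def indicatorFun {n : ℕ∞} (hn : 0 < n) (B : Set (Cube n)) : BoolFun where
  arity := n
  arity_pos := hn
  toFun x := decide (x ∈ B)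

lemma indicatorFun_eq_true {n : ℕ∞} (hn : 0 < n) {B : Set (Cube n)} {x : Cube n} :
    (indicatorFun hn B).toFun x = true ↔ x ∈ B := by
  simp [indicatorFun]

lemma up_eq_true {f : BoolFun} {x : Cube f.arity} :
    (up f).toFun x = true ↔ ∃ y, y ≤ x ∧ f.toFun y = true := by
  simp [up]

lemma preserves_indicatorFun {R : BoolRel} {n : ℕ∞} (hn : 0 < n) {B : Set (Cube n)}
    (h : ∀ p ∈ violations R n, ∃ i, p.1 i = true ∧ p.2 i ∉ B) :
    Preserves (indicatorFun hn B) R := by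
  intro x hx
  by_contra hS
  obtain ⟨i, hi, hiB⟩ := h (_, x) ⟨hS, hx⟩
  exact hiB ((indicatorFun_eq_true hn).1 hi)

/-- Every Borel polymorphism of a countable set of downward-closed Borel relations has its support
contained in a Borel upper set whose indicator is a polymorphism. -/
lemma exists_upperSet_indicatorFun_mem {M : Set BoolRel} (hM : M.Countable)
    (hBorel : ∀ R ∈ M, MeasurableSet R.carrier) (hdown : ∀ R ∈ M, IsLowerSet R.carrier)
    {f : BoolFun} (hf : f ∈ PolBorel M) :
    ∃ B : Set (Cube f.arity), IsUpperSet B ∧ {y | f.toFun y = true} ⊆ B ∧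
      indicatorFun f.arity_pos B ∈ PolBorel M ∩ Mono := by
  obtain ⟨hpol, hmeas⟩ := hf
  have hA : MeasurableSet {y | f.toFun y = true} := hmeas (measurableSet_singleton true)
  have hex : ∀ R : M, ∃ B : Set (Cube f.arity), MeasurableSet B ∧ IsUpperSet B ∧
      {y | f.toFun y = true} ⊆ B ∧
      ∀ p ∈ violations (R : BoolRel) f.arity, ∃ i, p.1 i = true ∧ p.2 i ∉ B := fun R =>
    exists_measurable_upperSet hA.analyticSet
      (measurableSet_violations (hBorel R R.2) f.arity).analyticSet
      fun p hp => exists_notMem_upperClosure (hdown R R.2) (hpol R R.2) hp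
  choose B hBm hBu hBA hB using hex
  have := hM.to_subtype
  have hup : IsUpperSet (⋂ R, B R) := isUpperSet_iInter hBu
  refine ⟨⋂ R, B R, hup, subset_iInter hBA, ⟨fun R hR => ?_, ?_⟩, ?_⟩
  · refine preserves_indicatorFun f.arity_pos fun p hp => ?_
    obtain ⟨i, hi, hiB⟩ := hB ⟨R, hR⟩ p hp
    exact ⟨i, hi, fun h => hiB (mem_iInter.1 h _)⟩
  · refine measurable_to_bool ?_
    have : (indicatorFun f.arity_pos (⋂ R, B R)).toFun ⁻¹' {true} = ⋂ R, B R :=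
      Set.ext fun _ => indicatorFun_eq_true _
    rw [this]
    exact MeasurableSet.iInter hBm
  · intro x y hxy
    refine Bool.le_iff_imp.2 fun hx => ?_
    exact (indicatorFun_eq_true _).2 (hup hxy ((indicatorFun_eq_true _).1 hx))

end BoolClone

theorem mainTheorem12
    (M : Set BoolClone.BoolRel) (hM : M.Countable)
    (hBorel : ∀ R ∈ M, MeasurableSet R.carrier)
    (hdown : ∀ R ∈ M, IsLowerSet R.carrier)
    (F : Set BoolClone.BoolFun) (hF : F = BoolClone.PolBorel M)
    (hconj : BoolClone.conj ∈ F) :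
    BoolClone.up '' F ⊆ BoolClone.down (F ∩ BoolClone.Mono) ∧
      F ⊆ BoolClone.down (F ∩ BoolClone.Mono) := by
  subst hF
  constructor
  · rintro _ ⟨f, hf, rfl⟩
    obtain ⟨B, hup, hB, hmem⟩ :=
      BoolClone.exists_upperSet_indicatorFun_mem hM hBorel hdown hf
    refine ⟨_, hmem, fun x => Bool.le_iff_imp.2 fun hx => ?_⟩
    obtain ⟨y, hyx, hy⟩ := BoolClone.up_eq_true.1 hx
    exact (BoolClone.indicatorFun_eq_true f.arity_pos).2 (hup hyx (hB hy))
  · intro f hf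
    obtain ⟨B, -, hB, hmem⟩ :=
      BoolClone.exists_upperSet_indicatorFun_mem hM hBorel hdown hf
    exact ⟨_, hmem, fun x => Bool.le_iff_imp.2 fun hx =>
      (BoolClone.indicatorFun_eq_true f.arity_pos).2 (hB hx)⟩
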